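/- Let $\Omega\subset\mathbb R^{n}\times\mathbb R^{m}$ be open and convex, let $\pi:\mathbb R^n\times\mathbb R^m\to\mathbb R^n$ be the projection, and suppose that $\Omega_x=\{y\in\mathbb R^m:(x,y)\in\Omega\}$ is connected for every $x\in\pi(\Omega)$. Let $f:\Omega\to\mathbb R$, and suppose that there are $\kappa\ge 0$ and $\sigma>0$ such that $$f(x,y)+\frac{\kappa}{2}\|x\|^2-\sigma\|y\|^2$$ is convex on $\Omega$, and that for every $x\in\pi(\Omega)$ the set $$\operatorname{argmin}_f(x)=\Big\{\gamma\in\Omega_x:\ f(x,\gamma)=\inf_{y\in\Omega_x}f(x,y)\Big\}$$ is non-empty. For $x\in\pi(\Omega)$ put $g(x)=\inf_{y\in\Omega_x}f(x,y)$, and for $x_0\in\pi(\Omega)$ let $$\nabla^\kappa_{x_0}g=\Big\{u\in\mathbb R^n:\ g(x)-g(x_0)\ge u\cdot(x-x_0)-\frac{\kappa}{2}\|x-x_0\|^2\ \text{ for all } x\in\pi(\Omega) \text{ sufficiently near } x_0\Big\}.$$ Then: (i) The function $g$ is $\kappa$-semiconvex on $\pi(\Omega)$, that is, $g(x)+\frac{\kappa}{2}\|x\|^2$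 is convex on $\pi(\Omega)$. Moreover, for every $x\in\pi(\Omega)$ the set $\operatorname{argmin}_f(x)$ consists of exactly one point, denoted $\gamma(x)$, so that $g(x)=f(x,\gamma(x))$. (ii) For every $x_0\in\pi(\Omega)$ and every $u_0\in\nabla^\kappa_{x_0}g$ there are an open neighbourhood $V$ of $(x_0,u_0)$ in $\mathbb R^{2n}$ and a Lipschitz function $\phi:V\to\mathbb R^m$ such that $\gamma(x)=\phi(x,u)$ for all $(x,u)\in V$ with $x\in\pi(\Omega)$ and $u\in\nabla^\kappa_x g$. (iii) The function $\gamma$ is calm at almost every point: for Lebesgue-almost every $x_0\in\pi(\Omega)$ there are $C$ and $\delta>0$ such that $$\|\gamma(x)-\gamma(x_0)\|\le C\|x-x_0\|\quad\text{for all } x\in\pi(\Omega) \text{ with } \|x-x_0\|<\delta.$$ -/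

import Mathlib

open Set Filter Topology MeasureTheory
open scoped NNReal

namespace ArgminCalm

/-- Euclidean space of dimension `n`. -/
abbrev Euc (n : ℕ) : Type := EuclideanSpace ℝ (Fin n)

/-- The fibre `{y | (x, y) ∈ Ω}` of `Ω` over `x`. -/
def fiber {n m : ℕ} (Ω : Set (Euc n × Euc m)) (x : Euc n) : Set (Euc m) :=
  {y | (x, y) ∈ Ω}

/-- The image of `Ω` under the projection to the first factor. -/
def base {n m : ℕ} (Ω : Set (Euc n × Euc m)) : Set (Euc n) :=
  Prod.fst '' Ω

/-- The marginal function `x ↦ inf {f (x, y) | y in the fibre over x}`. -/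
noncomputable def marginal {n m : ℕ} (Ω : Set (Euc n × Euc m)) (f : Euc n × Euc m → ℝ)
    (x : Euc n) : ℝ :=
  sInf ((fun y => f (x, y)) '' fiber Ω x)

/-- The set of those `y` in the fibre over `x` for which `f (x, y)` is the infimum of `f` over the
fibre. The infimum is expressed by `IsGLB`, so nothing is in the set if `f (x, ·)` is unbounded
below on the fibre. -/
def argmin {n m : ℕ} (Ω : Set (Euc n × Euc m)) (f : Euc n × Euc m → ℝ) (x : Euc n) :
    Set (Euc m) :=
  {y | y ∈ fiber Ω x ∧ IsGLB ((fun y' => f (x, y')) '' fiber Ω x) (f (x, y))}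

/-- The set of `u` with `g x - g x₀ ≥ u ⬝ (x - x₀) - (κ / 2) ‖x - x₀‖ ^ 2` for all `x` in the
domain `X` of `g` that are sufficiently near `x₀`. -/
def lowerSupport {n : ℕ} (κ : ℝ) (X : Set (Euc n)) (g : Euc n → ℝ) (x₀ : Euc n) :
    Set (Euc n) :=
  {u | ∀ᶠ x in 𝓝[X] x₀, g x - g x₀ ≥ inner ℝ u (x - x₀) - κ / 2 * ‖x - x₀‖ ^ 2}

/-- `g` is `κ`-semiconvex on `X`: the function `g + (κ / 2) ‖·‖ ^ 2` is convex on `X`. -/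
def SemiconvexOn {n : ℕ} (κ : ℝ) (X : Set (Euc n)) (g : Euc n → ℝ) : Prop :=
  ConvexOn ℝ X (fun x => g x + κ / 2 * ‖x‖ ^ 2)

end ArgminCalm

namespace ArgminCalm

/-! ### Subgradients, resolvents and almost-everywhere calmness of the subdifferential -/

section Subgradient

variable {E : Type*} [NormedAddCommGroup E] [InnerProductSpace ℝ E]

/-! Strong convexity in the fibre survives minimization: the convexity inequality for G = g +
(κ/2)‖·‖² gains a term σab‖y₀ - y₁‖² in the minimizers. This forces uniqueness and, played against
subgradients pᵢ of G at xᵢ, gives σ‖y₁ - y₀‖² ≤ ⟪p₁ - p₀, x₁ - x₀⟫ (`mul_norm_sq_sub_le_inner`).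
With p = u + κx, this makes γ Lipschitz in (x, u), and the function extends.

For calmness it remains to bound p - p₀ by x - x₀ for almost every x₀
(`ae_exists_isSubgrad_norm_le`). The resolvent J = (I + ∂G)⁻¹ is 1-Lipschitz on an open set. By
Rademacher and Sard, almost every x₀ avoids the images under J of the points where J is not
differentiable or has singular derivative. Elsewhere J expands distances near z₀ = x₀ + p₀, and
monotonicity makes its inverse calm at x₀. -/

/-- `p` is a subgradient at `x` of the function `G` on `X`. -/
def IsSubgrad (X : Set E) (G : E → ℝ) (x p : E) : Prop :=
  ∀ y ∈ X, G x + inner ℝ p (y - x) ≤ G y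

theorem IsSubgrad.inner_sub_nonneg {X : Set E} {G : E → ℝ} {x y p q : E}
    (hp : IsSubgrad X G x p) (hq : IsSubgrad X G y q) (hx : x ∈ X) (hy : y ∈ X) :
    0 ≤ inner ℝ (q - p) (y - x) := by
  have h1 := hp y hy
  have h2 := hq x hx
  rw [← neg_sub y x, inner_neg_right] at h2
  rw [inner_sub_left]
  linarith

/-- If `z = x + p` and `w = y + q` for subgradients `p`, `q` at `x`, `y`, then
`‖y - x‖ ^ 2 ≤ ⟪w - z, y - x⟫`. -/
theorem IsSubgrad.norm_sq_le_inner {X : Set E} {G : E → ℝ} {x y z w : E}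
    (hp : IsSubgrad X G x (z - x)) (hq : IsSubgrad X G y (w - y)) (hx : x ∈ X) (hy : y ∈ X) :
    ‖y - x‖ ^ 2 ≤ inner ℝ (w - z) (y - x) := by
  have h := hp.inner_sub_nonneg hq hx hy
  rw [show w - y - (z - x) = (w - z) - (y - x) by abel, inner_sub_left,
    real_inner_self_eq_norm_sq] at h
  linarith

theorem IsSubgrad.norm_sub_le {X : Set E} {G : E → ℝ} {x y z w : E}
    (hp : IsSubgrad X G x (z - x)) (hq : IsSubgrad X G y (w - y)) (hx : x ∈ X) (hy : y ∈ X) :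
    ‖y - x‖ ≤ ‖w - z‖ := by
  have h := (hp.norm_sq_le_inner hq hx hy).trans (real_inner_le_norm _ _)
  by_contra! hlt
  nlinarith [norm_nonneg (w - z), norm_nonneg (y - x)]

theorem le_of_forall_small_le_add_mul {a b c : ℝ}
    (h : ∀ᶠ t in 𝓝[>] (0 : ℝ), a ≤ b + t * c) : a ≤ b := by
  have h2 : Tendsto (fun t : ℝ => b + t * c) (𝓝[>] 0) (𝓝 (b + 0 * c)) :=
    (Continuous.tendsto (by fun_prop) 0).mono_left nhdsWithin_le_nhds
  simpa using ge_of_tendsto h2 h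

theorem eventually_segment_mem {s : Set E} {x y : E} (hs : s ∈ 𝓝 x) :
    ∀ᶠ t in 𝓝[>] (0 : ℝ), (1 - t) • x + t • y ∈ s := by
  have h2 : Tendsto (fun t : ℝ => (1 - t) • x + t • y) (𝓝[>] 0)
      (𝓝 ((1 - (0 : ℝ)) • x + (0 : ℝ) • y)) :=
    (Continuous.tendsto (by fun_prop) 0).mono_left nhdsWithin_le_nhds
  simp only [sub_zero, one_smul, zero_smul, add_zero] at h2
  exact h2 hs

theorem eventually_mem_Ioo_zero_one : ∀ᶠ t in 𝓝[>] (0 : ℝ), t ∈ Ioo (0 : ℝ) 1 :=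
  Ioo_mem_nhdsGT one_pos

theorem segment_sub_left (x y : E) (t : ℝ) : (1 - t) • x + t • y - x = t • (y - x) := by
  module

/-- A local support inequality with a quadratic error yields a subgradient. -/
theorem IsSubgrad.of_eventually {X : Set E} {G : E → ℝ} (hG : ConvexOn ℝ X G) {x p : E}
    (hx : x ∈ X) (K : ℝ)
    (h : ∀ᶠ y in 𝓝 x, y ∈ X → G x + inner ℝ p (y - x) - K * ‖y - x‖ ^ 2 ≤ G y) :
    IsSubgrad X G x p := by
  intro y hy
  -- On the segment the error is of order t², so it vanishes after dividing by t and letting t → 0.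
  refine le_of_forall_small_le_add_mul (c := K * ‖y - x‖ ^ 2) ?_
  filter_upwards [eventually_segment_mem (y := y) h, eventually_mem_Ioo_zero_one] with t h1 ht
  have hmem : (1 - t) • x + t • y ∈ X :=
    hG.1 hx hy (by linarith [ht.2]) ht.1.le (by ring)
  have h2 := h1 hmem
  have h3 := hG.2 hx hy (by linarith [ht.2] : 0 ≤ 1 - t) ht.1.le (by ring)
  rw [segment_sub_left, inner_smul_right, norm_smul, Real.norm_of_nonneg ht.1.le] at h2
  simp only [smul_eq_mul] at h3
  have h4 : t * (G x + inner ℝ p (y - x)) ≤ t * (G y + t * (K * ‖y - x‖ ^ 2)) := by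
    nlinarith
  exact le_of_mul_le_mul_left h4 ht.1

/-- The range of `x ↦ x + ∂G(x)`, the domain of the resolvent of `∂G`. -/
def resolventDomain (X : Set E) (G : E → ℝ) : Set E :=
  {z | ∃ x ∈ X, IsSubgrad X G x (z - x)}

/-- If the resolvent `J` expands distances to `z₀` by a fixed factor near `z₀`, then the inverse of
the resolvent is calm at `J z₀`. -/
theorem norm_sub_le_of_resolvent_expanding {X : Set E} {G : E → ℝ} {J : E → E} {z₀ : E} {C r : ℝ}
    (hC : 0 < C) (hr : 0 < r)
    (hJ : ∀ z ∈ resolventDomain X G, J z ∈ X ∧ IsSubgrad X G (J z) (z - J z))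
    (hz₀ : z₀ ∈ resolventDomain X G)
    (hexp : ∀ z, ‖z - z₀‖ ≤ r → z ∈ resolventDomain X G ∧ ‖z - z₀‖ ≤ C * ‖J z - J z₀‖)
    {z : E} (hz : z ∈ resolventDomain X G) (hlt : ‖J z - J z₀‖ < r / C ^ 2) :
    ‖z - z₀‖ ≤ C * ‖J z - J z₀‖ := by
  rcases le_or_gt ‖z - z₀‖ r with h | h
  · exact (hexp z h).2
  exfalso
  have hpos : 0 < ‖z - z₀‖ := hr.trans h
  -- Let w be the point of the segment at distance r from z₀. Monotonicity gives ⟪w - z₀, J z - J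
  -- z₀⟫ ≥ ‖J w - J z₀‖² ≥ (r/C)², hence ‖J z - J z₀‖ ≥ r/C².
  set s : ℝ := r / ‖z - z₀‖ with hs
  have hs0 : 0 < s := by positivity
  have hs1 : s < 1 := (div_lt_one hpos).2 h
  set w : E := z₀ + s • (z - z₀) with hw
  have hwz : w - z₀ = s • (z - z₀) := by rw [hw]; abel
  have hzw : z - w = (1 - s) • (z - z₀) := by rw [hw]; module
  have hnorm : ‖w - z₀‖ = r := by
    rw [hwz, norm_smul, Real.norm_of_nonneg hs0.le, hs]
    field_simp
  obtain ⟨hwZ, hwC⟩ := hexp w hnorm.le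
  rw [hnorm] at hwC
  have h1 := (hJ z₀ hz₀).2.norm_sq_le_inner (hJ w hwZ).2 (hJ z₀ hz₀).1 (hJ w hwZ).1
  have h2 := (hJ w hwZ).2.norm_sq_le_inner (hJ z hz).2 (hJ w hwZ).1 (hJ z hz).1
  rw [hzw, inner_smul_left] at h2
  have h3 : 0 ≤ inner ℝ (z - z₀) (J z - J w) := by
    refine nonneg_of_mul_nonneg_right (a := 1 - s) ?_ (by linarith)
    exact (sq_nonneg _).trans (by simpa using h2)
  have h4 : 0 ≤ inner ℝ (w - z₀) (J z - J w) := by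
    rw [hwz, inner_smul_left]
    exact mul_nonneg (by simpa using hs0.le) h3
  have h5 : inner ℝ (w - z₀) (J z - J z₀) =
      inner ℝ (w - z₀) (J z - J w) + inner ℝ (w - z₀) (J w - J z₀) := by
    rw [← inner_add_right]; congr 1; abel
  have h6 := real_inner_le_norm (w - z₀) (J z - J z₀)
  rw [hnorm] at h6
  have h7 : r * ‖J z - J z₀‖ < r * (r / C ^ 2) := mul_lt_mul_of_pos_left hlt hr
  have h8 : r * (r / C ^ 2) = (r / C) ^ 2 := by ring
  have h9 : r / C ≤ ‖J w - J z₀‖ := by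
    rw [div_le_iff₀ hC]; linarith
  have h10 : (r / C) ^ 2 ≤ ‖J w - J z₀‖ ^ 2 := by gcongr
  linarith

variable [FiniteDimensional ℝ E]

/-- A Lipschitz map of a finite-dimensional space sends null sets to null sets. -/
theorem measure_image_eq_zero_of_lipschitzOnWith [MeasurableSpace E] [BorelSpace E]
    (μ : Measure E) [μ.IsAddHaarMeasure] {K : ℝ≥0} {f : E → E} {s : Set E}
    (hf : LipschitzOnWith K f s) (hs : μ s = 0) : μ (f '' s) = 0 := by
  apply Measure.absolutelyContinuous_isAddHaarMeasure μ
    (Measure.hausdorffMeasure (Module.finrank ℝ E : ℝ))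
  have h0 := Measure.absolutelyContinuous_isAddHaarMeasure
    (Measure.hausdorffMeasure (X := E) (Module.finrank ℝ E : ℝ)) μ hs
  have h := hf.hausdorffMeasure_image_le (Nat.cast_nonneg (Module.finrank ℝ E))
  rwa [h0, mul_zero, nonpos_iff_eq_zero] at h

/-- A hyperplane separates (x, G x) from the open strict epigraph; it is not vertical, so its slope
is a subgradient. -/
theorem exists_isSubgrad {X : Set E} {G : E → ℝ} (hX : IsOpen X) (hG : ConvexOn ℝ X G) {x : E}
    (hx : x ∈ X) : ∃ p, IsSubgrad X G x p := by
  have hopen : IsOpen {q : E × ℝ | q.1 ∈ X ∧ G q.1 < q.2} := by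
    have hc : ContinuousOn (fun q : E × ℝ => q.2 - G q.1) (X ×ˢ univ) :=
      continuousOn_snd.sub ((hG.continuousOn hX).comp continuousOn_fst fun q hq => hq.1)
    have := hc.isOpen_inter_preimage (hX.prod isOpen_univ) (isOpen_Ioi (a := (0 : ℝ)))
    convert this using 1
    ext q
    simp
  obtain ⟨L, hL⟩ := geometric_hahn_banach_open_point (x := (x, G x)) hG.convex_strict_epigraph
    hopen (by simp)
  have hdecomp : ∀ (v : E) (t : ℝ), L (v, t) = L (v, 0) + t * L (0, 1) := by
    intro v t
    have : ((v, t) : E × ℝ) = (v, 0) + t • (0, 1) := by simp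
    rw [this, map_add, map_smul, smul_eq_mul]
  have hneg : L (0, 1) < 0 := by
    have := hL (x, G x + 1) ⟨hx, by simp⟩
    rw [hdecomp, hdecomp x (G x)] at this
    linarith
  have hle : ∀ y ∈ X, L (y, 0) + G y * L (0, 1) ≤ L (x, 0) + G x * L (0, 1) := by
    intro y hy
    refine le_of_forall_small_le_add_mul (c := - L (0, 1)) ?_
    filter_upwards [self_mem_nhdsWithin] with t ht
    have := hL (y, G y + t) ⟨hy, by simpa using ht⟩
    rw [hdecomp, hdecomp x (G x)] at this
    linarith
  let ℓ : E →L[ℝ] ℝ := (-(L (0, 1))⁻¹) • L.comp (.inl ℝ E ℝ)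
  refine ⟨(InnerProductSpace.toDual ℝ E).symm ℓ, fun y hy => ?_⟩
  rw [InnerProductSpace.toDual_symm_apply]
  have h1 : ℓ (y - x) = -(L (0, 1))⁻¹ * (L (y, 0) - L (x, 0)) := by
    rw [map_sub]
    simp [ℓ]
    ring
  have h2 := hle y hy
  rw [h1]
  have h3 : (L (0, 1)) * (-(L (0, 1))⁻¹ * (L (y, 0) - L (x, 0))) = -(L (y, 0) - L (x, 0)) := by
    field_simp [hneg.ne]
  nlinarith

/-- A local minimum x of G + ‖· - z‖²/2 has z - x as a subgradient. The minimizer over a closed ball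
about x₀ lies within 2‖z - z₀‖ of x₀, hence in the interior for z near z₀. -/
theorem isOpen_resolventDomain {X : Set E} {G : E → ℝ} (hX : IsOpen X) (hG : ConvexOn ℝ X G) :
    IsOpen (resolventDomain X G) := by
  rw [Metric.isOpen_iff]
  rintro z₀ ⟨x₀, hx₀, hp₀⟩
  obtain ⟨r, hr, hrX⟩ := Metric.nhds_basis_closedBall.mem_iff.1 (hX.mem_nhds hx₀)
  refine ⟨r / 2, by positivity, fun z hz => ?_⟩
  rw [Metric.mem_ball, dist_eq_norm] at hz
  have hcont : ContinuousOn (fun x => G x + ‖x - z‖ ^ 2 / 2) (Metric.closedBall x₀ r) :=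
    ((hG.continuousOn hX).mono hrX).add (by fun_prop)
  obtain ⟨x, hx, hmin⟩ := (isCompact_closedBall x₀ r).exists_isMinOn
    ⟨x₀, Metric.mem_closedBall_self hr.le⟩ hcont
  have hxX := hrX hx
  have hexp : ∀ a b : E, ‖b - z‖ ^ 2 = ‖a - z‖ ^ 2 + 2 * inner ℝ (a - z) (b - a)
      + ‖b - a‖ ^ 2 := by
    intro a b
    rw [show b - z = (a - z) + (b - a) by abel, norm_add_sq_real]
  have hlt : ‖x - x₀‖ < r := by
    by_contra! hge
    have h1 : G x + ‖x - z‖ ^ 2 / 2 ≤ G x₀ + ‖x₀ - z‖ ^ 2 / 2 :=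
      hmin (Metric.mem_closedBall_self hr.le)
    have h2 := hp₀ x hxX
    rw [hexp x₀ x] at h1
    have h3 : inner ℝ (z₀ - x₀) (x - x₀) + inner ℝ (x₀ - z) (x - x₀) =
        inner ℝ (z₀ - z) (x - x₀) := by
      rw [← inner_add_left]; congr 1; abel
    have h4 := neg_le_of_abs_le (abs_real_inner_le_norm (z₀ - z) (x - x₀))
    rw [norm_sub_rev z₀ z] at h4
    nlinarith
  refine ⟨x, hxX, IsSubgrad.of_eventually hG hxX (1 / 2) ?_⟩
  have hball : ∀ᶠ y in 𝓝 x, y ∈ Metric.ball x₀ r :=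
    Metric.isOpen_ball.mem_nhds (by rwa [Metric.mem_ball, dist_eq_norm])
  filter_upwards [hball] with y hy _
  have h1 : G x + ‖x - z‖ ^ 2 / 2 ≤ G y + ‖y - z‖ ^ 2 / 2 := hmin (Metric.ball_subset_closedBall hy)
  rw [hexp x y] at h1
  have h2 : inner ℝ (z - x) (y - x) = - inner ℝ (x - z) (y - x) := by
    rw [← inner_neg_left, neg_sub]
  rw [h2]
  linarith

/-- At almost every point, the subdifferential of a convex function is calm. -/
theorem ae_exists_isSubgrad_norm_le [MeasurableSpace E] [BorelSpace E] (μ : Measure E)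
    [μ.IsAddHaarMeasure] {X : Set E} {G : E → ℝ} (hX : IsOpen X) (hG : ConvexOn ℝ X G) :
    ∀ᵐ x₀ ∂μ, x₀ ∈ X → ∃ p₀, IsSubgrad X G x₀ p₀ ∧ ∃ C δ : ℝ, 0 < C ∧ 0 < δ ∧
      ∀ x ∈ X, ‖x - x₀‖ < δ → ∀ p, IsSubgrad X G x p →
        ‖(x + p) - (x₀ + p₀)‖ ≤ C * ‖x - x₀‖ := by
  have hZ := isOpen_resolventDomain hX hG
  have hJ' : ∀ z, ∃ x, z ∈ resolventDomain X G → x ∈ X ∧ IsSubgrad X G x (z - x) := by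
    intro z
    by_cases hz : z ∈ resolventDomain X G
    · obtain ⟨x, hx⟩ := hz
      exact ⟨x, fun _ => hx⟩
    · exact ⟨0, fun h => absurd h hz⟩
  choose J hJ using hJ'
  have hJeq : ∀ x ∈ X, ∀ p, IsSubgrad X G x p →
      x + p ∈ resolventDomain X G ∧ J (x + p) = x := by
    intro x hx p hp
    have hp' : IsSubgrad X G x (x + p - x) := by rwa [add_sub_cancel_left]
    have hz : x + p ∈ resolventDomain X G := ⟨x, hx, hp'⟩
    refine ⟨hz, ?_⟩
    have := hp'.norm_sub_le (hJ _ hz).2 hx (hJ _ hz).1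
    rw [sub_self, norm_zero, norm_le_zero_iff, sub_eq_zero] at this
    exact this
  have hLip : LipschitzOnWith 1 J (resolventDomain X G) := by
    refine LipschitzOnWith.of_dist_le_mul fun z hz w hw => ?_
    rw [dist_eq_norm, dist_eq_norm, NNReal.coe_one, one_mul]
    exact (hJ w hw).2.norm_sub_le (hJ z hz).2 (hJ w hw).1 (hJ z hz).1
  set N : Set E := {z | z ∈ resolventDomain X G ∧
    ¬ DifferentiableWithinAt ℝ J (resolventDomain X G) z}
  set D : Set E := {z | z ∈ resolventDomain X G ∧ DifferentiableAt ℝ J z ∧ (fderiv ℝ J z).det = 0}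
  have hN : μ N = 0 := by
    have h := hLip.ae_differentiableWithinAt_of_mem (μ := μ)
    rw [ae_iff] at h
    simpa only [Classical.not_imp] using h
  have hJN : μ (J '' N) = 0 :=
    measure_image_eq_zero_of_lipschitzOnWith μ (hLip.mono fun z hz => hz.1) hN
  have hJD : μ (J '' D) = 0 :=
    addHaar_image_eq_zero_of_det_fderivWithin_eq_zero μ (f' := fderiv ℝ J)
      (fun z hz => hz.2.1.hasFDerivAt.hasFDerivWithinAt) fun z hz => hz.2.2
  filter_upwards [measure_eq_zero_iff_ae_notMem.1 hJN, measure_eq_zero_iff_ae_notMem.1 hJD]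
    with x₀ hx₀N hx₀D hx₀
  obtain ⟨p₀, hp₀⟩ := exists_isSubgrad hX hG hx₀
  refine ⟨p₀, hp₀, ?_⟩
  obtain ⟨hz₀, hJz₀⟩ := hJeq x₀ hx₀ p₀ hp₀
  set z₀ := x₀ + p₀ with hz₀def
  have hdiff : DifferentiableAt ℝ J z₀ := by
    by_contra h
    refine hx₀N ⟨z₀, ⟨hz₀, fun h' => h (h'.differentiableAt (hZ.mem_nhds hz₀))⟩, hJz₀⟩
  have hdet : (fderiv ℝ J z₀).det ≠ 0 := fun h => hx₀D ⟨z₀, ⟨hz₀, hdiff, h⟩, hJz₀⟩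
  let A := (fderiv ℝ J z₀).toContinuousLinearEquivOfDetNeZero hdet
  -- Since the derivative is invertible, z - z₀ = O(J z - J z₀).
  have hO := (hdiff.hasFDerivAt.isTheta_sub A.toHomeomorph.isInducing).isBigO_symm
  obtain ⟨C, hC, hCO⟩ := hO.exists_pos
  obtain ⟨r, hr, hball⟩ := Metric.nhds_basis_closedBall.mem_iff.1
    (Filter.inter_mem hCO.bound (hZ.mem_nhds hz₀))
  refine ⟨C, r / C ^ 2, hC, by positivity, fun x hx hlt p hp => ?_⟩
  obtain ⟨hz, hJz⟩ := hJeq x hx p hp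
  have := norm_sub_le_of_resolvent_expanding hC hr hJ hz₀
    (fun z hz => (hball (by rwa [Metric.mem_closedBall, dist_eq_norm])).symm) hz
  rw [hJz, hJz₀] at this
  exact this hlt

end Subgradient

/-! ### The marginal function and its minimizers -/

section Marginal

variable {n m : ℕ} {Ω : Set (Euc n × Euc m)} {f : Euc n × Euc m → ℝ}

theorem norm_sq_convex_combination {F : Type*} [NormedAddCommGroup F] [InnerProductSpace ℝ F]
    (x y : F) {a b : ℝ} (hab : a + b = 1) :
    ‖a • x + b • y‖ ^ 2 = a * ‖x‖ ^ 2 + b * ‖y‖ ^ 2 - a * b * ‖x - y‖ ^ 2 := by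
  rw [norm_add_sq_real, norm_sub_sq_real, norm_smul, norm_smul, inner_smul_left,
    inner_smul_right, mul_pow, mul_pow, Real.norm_eq_abs, Real.norm_eq_abs, sq_abs, sq_abs]
  obtain rfl : b = 1 - a := by linarith
  simp only [conj_trivial]
  ring

theorem marginal_eq_of_mem_argmin {x : Euc n} {y : Euc m} (hy : y ∈ argmin Ω f x) :
    marginal Ω f x = f (x, y) :=
  hy.2.csInf_eq ⟨_, y, hy.1, rfl⟩

theorem marginal_le {x : Euc n} {y : Euc m} (hx : (argmin Ω f x).Nonempty) (hy : (x, y) ∈ Ω) :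
    marginal Ω f x ≤ f (x, y) := by
  obtain ⟨z, hz⟩ := hx
  rw [marginal_eq_of_mem_argmin hz]
  exact hz.2.1 ⟨y, hy, rfl⟩

theorem isOpen_base (hΩ : IsOpen Ω) : IsOpen (base Ω) :=
  isOpenMap_fst _ hΩ

theorem convex_base (hΩ : Convex ℝ Ω) : Convex ℝ (base Ω) :=
  hΩ.linear_image (LinearMap.fst ℝ (Euc n) (Euc m))

/-- The convexity inequality for the marginal function, with the gain coming from the strong
convexity in the fibre variable. -/
theorem marginal_convex_combination_add_le {κ σ : ℝ}
    (hf : ConvexOn ℝ Ω (fun p => f p + κ / 2 * ‖p.1‖ ^ 2 - σ * ‖p.2‖ ^ 2))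
    (hargmin : ∀ x ∈ base Ω, (argmin Ω f x).Nonempty) {x₀ x₁ : Euc n} {y₀ y₁ : Euc m}
    (h₀ : y₀ ∈ argmin Ω f x₀) (h₁ : y₁ ∈ argmin Ω f x₁) {a b : ℝ} (ha : 0 ≤ a) (hb : 0 ≤ b)
    (hab : a + b = 1) :
    marginal Ω f (a • x₀ + b • x₁) + κ / 2 * ‖a • x₀ + b • x₁‖ ^ 2
        + σ * (a * b * ‖y₀ - y₁‖ ^ 2) ≤
      a * (marginal Ω f x₀ + κ / 2 * ‖x₀‖ ^ 2) + b * (marginal Ω f x₁ + κ / 2 * ‖x₁‖ ^ 2) := by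
  -- The combination of the two minimizers is a competitor over the combined base point.
  have hmem : (a • x₀ + b • x₁, a • y₀ + b • y₁) ∈ Ω := hf.1 h₀.1 h₁.1 ha hb hab
  have h := hf.2 h₀.1 h₁.1 ha hb hab
  have hle := marginal_le (hargmin _ ⟨_, hmem, rfl⟩) hmem
  simp only [smul_eq_mul, Prod.smul_mk, Prod.mk_add_mk] at h
  rw [norm_sq_convex_combination y₀ y₁ hab] at h
  rw [marginal_eq_of_mem_argmin h₀, marginal_eq_of_mem_argmin h₁]
  linarith

theorem semiconvexOn_marginal {κ σ : ℝ} (hσ : 0 < σ)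
    (hf : ConvexOn ℝ Ω (fun p => f p + κ / 2 * ‖p.1‖ ^ 2 - σ * ‖p.2‖ ^ 2))
    (hargmin : ∀ x ∈ base Ω, (argmin Ω f x).Nonempty) :
    SemiconvexOn κ (base Ω) (marginal Ω f) := by
  refine ⟨convex_base hf.1, fun x₀ hx₀ x₁ hx₁ a b ha hb hab => ?_⟩
  obtain ⟨y₀, h₀⟩ := hargmin x₀ hx₀
  obtain ⟨y₁, h₁⟩ := hargmin x₁ hx₁
  refine le_trans (le_add_of_nonneg_right ?_)
    (marginal_convex_combination_add_le hf hargmin h₀ h₁ ha hb hab)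
  positivity

/-- Minimizers over two points are controlled by the subgradients at these points. -/
theorem mul_norm_sq_sub_le_inner {κ σ : ℝ}
    (hf : ConvexOn ℝ Ω (fun p => f p + κ / 2 * ‖p.1‖ ^ 2 - σ * ‖p.2‖ ^ 2))
    (hargmin : ∀ x ∈ base Ω, (argmin Ω f x).Nonempty) {x₀ x₁ p₀ p₁ : Euc n} {y₀ y₁ : Euc m}
    (h₀ : y₀ ∈ argmin Ω f x₀) (h₁ : y₁ ∈ argmin Ω f x₁)
    (hp₀ : IsSubgrad (base Ω) (fun x => marginal Ω f x + κ / 2 * ‖x‖ ^ 2) x₀ p₀)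
    (hp₁ : IsSubgrad (base Ω) (fun x => marginal Ω f x + κ / 2 * ‖x‖ ^ 2) x₁ p₁) :
    σ * ‖y₁ - y₀‖ ^ 2 ≤ inner ℝ (p₁ - p₀) (x₁ - x₀) := by
  have hx₀ : x₀ ∈ base Ω := ⟨_, h₀.1, rfl⟩
  have hx₁ : x₁ ∈ base Ω := ⟨_, h₁.1, rfl⟩
  -- The gain is σt(1 - t)‖y₁ - y₀‖²: divide by t and let t → 0.
  refine le_of_forall_small_le_add_mul (c := σ * ‖y₁ - y₀‖ ^ 2) ?_
  filter_upwards [eventually_mem_Ioo_zero_one] with t ht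
  have ht' : 0 ≤ 1 - t := by linarith [ht.2]
  have h := marginal_convex_combination_add_le hf hargmin h₀ h₁ ht' ht.1.le (by ring)
  have h2 := hp₀ _ (convex_base hf.1 hx₀ hx₁ ht' ht.1.le (by ring))
  have h3 := hp₁ _ hx₀
  rw [segment_sub_left, inner_smul_right] at h2
  rw [← neg_sub x₁ x₀, inner_neg_right] at h3
  rw [norm_sub_rev y₀ y₁] at h
  rw [inner_sub_left]
  have h4 : t * (σ * ‖y₁ - y₀‖ ^ 2) ≤ t * (inner ℝ p₁ (x₁ - x₀) - inner ℝ p₀ (x₁ - x₀)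
      + t * (σ * ‖y₁ - y₀‖ ^ 2)) := by
    nlinarith [mul_le_mul_of_nonneg_left h3 ht.1.le]
  exact le_of_mul_le_mul_left h4 ht.1

theorem argmin_subsingleton {κ σ : ℝ} (hσ : 0 < σ)
    (hf : ConvexOn ℝ Ω (fun p => f p + κ / 2 * ‖p.1‖ ^ 2 - σ * ‖p.2‖ ^ 2))
    (hargmin : ∀ x ∈ base Ω, (argmin Ω f x).Nonempty) (x : Euc n) :
    (argmin Ω f x).Subsingleton := by
  intro y₀ h₀ y₁ h₁
  have h := marginal_convex_combination_add_le hf hargmin h₀ h₁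
    (a := 1 / 2) (b := 1 / 2) (by norm_num) (by norm_num) (by norm_num)
  rw [← add_smul, show (1 / 2 + 1 / 2 : ℝ) = 1 by norm_num, one_smul] at h
  have h1 : σ * ‖y₀ - y₁‖ ^ 2 ≤ 0 := by linarith
  have h2 : ‖y₀ - y₁‖ ^ 2 = 0 :=
    le_antisymm (nonpos_of_mul_nonpos_right h1 hσ) (sq_nonneg _)
  rwa [sq_eq_zero_iff, norm_eq_zero, sub_eq_zero] at h2

theorem isSubgrad_of_mem_lowerSupport {κ : ℝ} {X : Set (Euc n)} {g : Euc n → ℝ}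
    (hX : IsOpen X) (hg : SemiconvexOn κ X g) {x u : Euc n} (hx : x ∈ X)
    (hu : u ∈ lowerSupport κ X g x) :
    IsSubgrad X (fun x => g x + κ / 2 * ‖x‖ ^ 2) x (u + κ • x) := by
  -- No error is left: expanding (κ/2)‖y‖² about x cancels it exactly and shifts u by κx.
  refine IsSubgrad.of_eventually hg hx 0 ?_
  have hu' : ∀ᶠ y in 𝓝[X] x, g y - g x ≥ inner ℝ u (y - x) - κ / 2 * ‖y - x‖ ^ 2 := hu
  rw [hX.nhdsWithin_eq hx] at hu'
  filter_upwards [hu'] with y hy _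
  have h1 : ‖y‖ ^ 2 = ‖x‖ ^ 2 + 2 * inner ℝ x (y - x) + ‖y - x‖ ^ 2 := by
    rw [← norm_add_sq_real, add_sub_cancel]
  rw [inner_add_left, inner_smul_left, h1]
  simp only [conj_trivial]
  linarith

/-- A map controlled by `σ ‖y₁ - y₀‖ ^ 2 ≤ ⟪p₁ - p₀, x₁ - x₀⟫`, where `p = u + κ x`, is a Lipschitz
function of `(x, u)`. -/
theorem norm_sub_le_of_mul_norm_sq_le_inner {κ σ : ℝ} (hσ : 0 < σ) (hκ : 0 ≤ κ)
    {x₀ x₁ u₀ u₁ : Euc n} {y₀ y₁ : Euc m}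
    (h : σ * ‖y₁ - y₀‖ ^ 2 ≤ inner ℝ ((u₁ + κ • x₁) - (u₀ + κ • x₀)) (x₁ - x₀)) :
    ‖y₁ - y₀‖ ≤ √((1 + κ) / σ) * ‖(x₁, u₁) - (x₀, u₀)‖ := by
  set r := ‖(x₁, u₁) - (x₀, u₀)‖
  have hx : ‖x₁ - x₀‖ ≤ r := norm_fst_le ((x₁, u₁) - (x₀, u₀))
  have hu : ‖u₁ - u₀‖ ≤ r := norm_snd_le ((x₁, u₁) - (x₀, u₀))
  rw [show (u₁ + κ • x₁) - (u₀ + κ • x₀) = (u₁ - u₀) + κ • (x₁ - x₀) by module, inner_add_left,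
    inner_smul_left, real_inner_self_eq_norm_sq] at h
  simp only [conj_trivial] at h
  have h1 := real_inner_le_norm (u₁ - u₀) (x₁ - x₀)
  have h2 : ‖u₁ - u₀‖ * ‖x₁ - x₀‖ ≤ r * r :=
    mul_le_mul hu hx (norm_nonneg _) (norm_nonneg _)
  have h3 : κ * ‖x₁ - x₀‖ ^ 2 ≤ κ * r ^ 2 := by gcongr
  have h4 : ‖y₁ - y₀‖ ^ 2 ≤ (1 + κ) / σ * r ^ 2 := by
    rw [div_mul_eq_mul_div, le_div_iff₀ hσ]
    linarith
  have hr : 0 ≤ r := norm_nonneg _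
  rw [← Real.sqrt_sq hr, ← Real.sqrt_mul (by positivity)]
  exact Real.le_sqrt_of_sq_le h4

end Marginal

end ArgminCalm

/-! ### The main theorem -/

open ArgminCalm in
theorem mainTheorem3 (n m : ℕ)
    (Ω : Set (ArgminCalm.Euc n × ArgminCalm.Euc m))
    (hΩ_open : IsOpen Ω) (hΩ_convex : Convex ℝ Ω)
    (hΩ_fiber : ∀ x ∈ ArgminCalm.base Ω, IsConnected (ArgminCalm.fiber Ω x))
    (f : ArgminCalm.Euc n × ArgminCalm.Euc m → ℝ)
    (κ σ : ℝ) (hκ : 0 ≤ κ) (hσ : 0 < σ)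
    (hf : ConvexOn ℝ Ω (fun p => f p + κ / 2 * ‖p.1‖ ^ 2 - σ * ‖p.2‖ ^ 2))
    (hargmin : ∀ x ∈ ArgminCalm.base Ω, (ArgminCalm.argmin Ω f x).Nonempty) :
    ArgminCalm.SemiconvexOn κ (ArgminCalm.base Ω) (ArgminCalm.marginal Ω f) ∧
    ∃ γ : ArgminCalm.Euc n → ArgminCalm.Euc m,
      (∀ x ∈ ArgminCalm.base Ω,
        ArgminCalm.argmin Ω f x = {γ x} ∧ ArgminCalm.marginal Ω f x = f (x, γ x)) ∧
      (∀ x₀ ∈ ArgminCalm.base Ω,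
        ∀ u₀ ∈ ArgminCalm.lowerSupport κ (ArgminCalm.base Ω) (ArgminCalm.marginal Ω f) x₀,
          ∃ (V : Set (ArgminCalm.Euc n × ArgminCalm.Euc n))
            (φ : ArgminCalm.Euc n × ArgminCalm.Euc n → ArgminCalm.Euc m),
            IsOpen V ∧ (x₀, u₀) ∈ V ∧ (∃ K : ℝ≥0, LipschitzOnWith K φ V) ∧
            ∀ x ∈ ArgminCalm.base Ω,
              ∀ u ∈ ArgminCalm.lowerSupport κ (ArgminCalm.base Ω) (ArgminCalm.marginal Ω f) x,
                (x, u) ∈ V → γ x = φ (x, u)) ∧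
      (∀ᵐ x₀ ∂(volume : Measure (ArgminCalm.Euc n)), x₀ ∈ ArgminCalm.base Ω →
        ∃ C δ : ℝ, 0 < δ ∧ ∀ x ∈ ArgminCalm.base Ω, ‖x - x₀‖ < δ →
          ‖γ x - γ x₀‖ ≤ C * ‖x - x₀‖) := by
  have hX := isOpen_base hΩ_open
  have hG := semiconvexOn_marginal hσ hf hargmin
  refine ⟨hG, ?_⟩
  choose! γ hγ using hargmin
  have hargmin : ∀ x ∈ base Ω, (argmin Ω f x).Nonempty := fun x hx => ⟨γ x, hγ x hx⟩
  refine ⟨γ, fun x hx => ⟨?_, marginal_eq_of_mem_argmin (hγ x hx)⟩, ?_, ?_⟩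
  · exact (argmin_subsingleton hσ hf hargmin x).eq_singleton_of_mem (hγ x hx)
  · intro x₀ hx₀ u₀ hu₀
    have hLip : LipschitzOnWith (√((1 + κ) / σ)).toNNReal (fun q : Euc n × Euc n => γ q.1)
        {q | q.1 ∈ base Ω ∧ q.2 ∈ lowerSupport κ (base Ω) (marginal Ω f) q.1} := by
      refine LipschitzOnWith.of_dist_le_mul fun q hq q' hq' => ?_
      rw [dist_eq_norm, dist_eq_norm, Real.coe_toNNReal _ (Real.sqrt_nonneg _)]
      exact norm_sub_le_of_mul_norm_sq_le_inner hσ hκ <|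
        mul_norm_sq_sub_le_inner hf hargmin (hγ _ hq'.1) (hγ _ hq.1)
          (isSubgrad_of_mem_lowerSupport hX hG hq'.1 hq'.2)
          (isSubgrad_of_mem_lowerSupport hX hG hq.1 hq.2)
    obtain ⟨φ, hφ, heq⟩ := hLip.extend_finite_dimension
    -- The Lipschitz bound holds on the whole graph of supports, so V need not be small.
    exact ⟨univ, φ, isOpen_univ, mem_univ _, ⟨_, hφ.lipschitzOnWith⟩,
      fun x hx u hu _ => heq (x := (x, u)) ⟨hx, hu⟩⟩
  · filter_upwards [ae_exists_isSubgrad_norm_le volume hX hG] with x₀ h hx₀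
    obtain ⟨p₀, hp₀, C, δ, hC, hδ, hcalm⟩ := h hx₀
    refine ⟨√(C / σ), δ, hδ, fun x hx hlt => ?_⟩
    -- Any subgradient at x will do, since the calmness bound covers them all.
    obtain ⟨p, hp⟩ := exists_isSubgrad hX hG hx
    have h1 := mul_norm_sq_sub_le_inner hf hargmin (hγ _ hx₀) (hγ _ hx) hp₀ hp
    have h2 := hcalm x hx hlt p hp
    have h3 := real_inner_le_norm ((x + p) - (x₀ + p₀)) (x - x₀)
    rw [show (x + p) - (x₀ + p₀) = (p - p₀) + (x - x₀) by abel] at h2 h3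
    rw [inner_add_left, real_inner_self_eq_norm_sq] at h3
    have h4 : ‖γ x - γ x₀‖ ^ 2 ≤ C / σ * ‖x - x₀‖ ^ 2 := by
      rw [div_mul_eq_mul_div, le_div_iff₀ hσ]
      nlinarith [mul_le_mul_of_nonneg_right h2 (norm_nonneg (x - x₀)), sq_nonneg ‖x - x₀‖]
    rw [← Real.sqrt_sq (norm_nonneg (x - x₀)), ← Real.sqrt_mul (by positivity)]
    exact Real.le_sqrt_of_sq_le h4
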